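/- Let $\lambda\in\mathbb R$ be an algebraic unit: its minimal polynomial $p$ over $\mathbb Z$ is monic and irreducible, of degree $g$, with constant coefficient $\pm1$. Call $\lambda$ a Perron unit if $|\lambda|>1$ and $\lambda$ is the unique root of largest modulus of the self-reciprocal polynomial $q(t)=t^{g}p(t)p(t^{-1})$, i.e. $|z|<|\lambda|$ for every complex root $z\neq\lambda$ of $q$. An integral symplectic form on $\mathbb Z^{2h}$ is given by a skew-symmetric integer $2h\times 2h$ matrix $L$ with $\det L\neq0$, and an integer matrix $M$ preserves it if $M^{T}LM=L$. A matrix with nonnegative entries is Perron–Frobenius if some positive power of it has only strictly positive entries. Let $\lambda$ be a Perron unit of degree $g$, and let $L$ be any integral symplectic form on $\mathbb Z^{2h}$, where $h\ge g$ (in particular $h=g$ is allowed). Then there are an integer $n\ge1$ and an integral $2h\times2h$ Perron–Frobenius matrix $M$ that preserves $L$ and whose spectral radius is $\lambda^{n}$. -/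

import Mathlib

open Polynomial Matrix

namespace PerronUnit

/-- The self-reciprocal polynomial `q(t) = t ^ g * p(t) * p(t⁻¹)` attached to a polynomial `p` of
degree `g` (`Polynomial.reverse p` is `t ^ g * p(t⁻¹)`). -/
noncomputable def selfReciprocal (p : ℤ[X]) : ℤ[X] :=
  p * p.reverse

/-- A real number `lam` is an algebraic unit: it is an algebraic integer and the constant
coefficient of its (monic, irreducible) minimal polynomial over `ℤ` is `1` or `-1`. -/
def IsAlgebraicUnit (lam : ℝ) : Prop :=
  IsIntegral ℤ lam ∧ ((minpoly ℤ lam).coeff 0 = 1 ∨ (minpoly ℤ lam).coeff 0 = -1)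

/-- A Perron unit: a real algebraic unit `lam` with `|lam| > 1` which is the unique root of largest
modulus of `t ^ g * p(t) * p(t⁻¹)`, where `p` is its minimal polynomial, of degree `g`. In other
words `|lam|` exceeds the modulus of each of the conjugates of `lam` and their inverses, except for
`lam` itself. (That `lam` is a simple root of `p` is automatic, `p` being irreducible.) -/
structure IsPerronUnit (lam : ℝ) : Prop where
  isAlgebraicUnit : IsAlgebraicUnit lam
  one_lt_abs : 1 < |lam|
  norm_lt : ∀ z : ℂ, aeval z (selfReciprocal (minpoly ℤ lam)) = 0 → z ≠ (lam : ℂ) → ‖z‖ < |lam|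

/-- `L` is the Gram matrix of an integral symplectic form: a skew-symmetric integer matrix that is
nondegenerate (not necessarily unimodular). -/
structure IsIntegralSymplecticForm {m : ℕ} (L : Matrix (Fin m) (Fin m) ℤ) : Prop where
  skew : Lᵀ = -L
  nondegenerate : L.det ≠ 0

/-- The integer matrix `M` preserves the bilinear form with Gram matrix `L`. -/
def PreservesForm {m : ℕ} (M L : Matrix (Fin m) (Fin m) ℤ) : Prop :=
  Mᵀ * L * M = L

/-- The spectral radius of an integer matrix: the largest modulus of its complex eigenvalues. -/
noncomputable def intSpectralRadius {m : ℕ} (M : Matrix (Fin m) (Fin m) ℤ) : ℝ :=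
  (spectralRadius ℂ (M.map (Int.cast : ℤ → ℂ))).toReal

end PerronUnit

/-! Over `ℚ` every two nondegenerate alternating forms of the same dimension are isometric, so only
the size of `L` matters: it suffices to find an isometry `T` of some rational symplectic space of
dimension at most `2h` that has `lam` as simple dominant eigenvalue and is killed by a monic integer
polynomial with constant coefficient `±1`. Such a space comes from `K = ℚ(lam)`. If `lam⁻¹` is a
conjugate of `lam`, take `K` with a skew-Hermitian trace form and multiplication by `lam`
(`primitive_of_reciprocal`). Otherwise take `K × K` with the hyperbolic trace form and
multiplication by `(lam, lam⁻¹)` (`primitive_of_not_reciprocal`). Missing dimensions are filled by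
the identity.

Positivity: if `v` and `w` are the right and left `lam`-eigenvectors, then `(v, L⁻¹w)` is a
hyperbolic pair after scaling. Real transvections move it to a pair whose eigenvectors are positive;
this is an open condition, so rational transvections do it too (`exists_rational_symplectic_pos`).
The conjugated matrix `B` satisfies `lam⁻ᵏBᵏ → v wᵀ > 0`.

Integrality: conjugation keeps the annihilating polynomial, and this forces some power of `B` to be
integral (`exists_pow_eq_map_intCast`). A large even multiple of that exponent serves both purposes.
-/

namespace PerronUnit

/-! ### Alternating forms over a field -/

/-- Two nondegenerate alternating forms of the same dimension are related by a form-preserving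
linear map. -/
theorem exists_linearMap_preserving_alternating {K : Type*} [Field K] (n : ℕ) :
    ∀ {V V' : Type} [AddCommGroup V] [Module K V] [FiniteDimensional K V]
      [AddCommGroup V'] [Module K V'] [FiniteDimensional K V']
      (B : V →ₗ[K] V →ₗ[K] K) (B' : V' →ₗ[K] V' →ₗ[K] K),
      (∀ x, B x x = 0) → (∀ x, B' x x = 0) →
      (∀ x, (∀ y, B x y = 0) → x = 0) → (∀ x, (∀ y, B' x y = 0) → x = 0) →
      Module.finrank K V = n → Module.finrank K V' = n →
      ∃ f : V →ₗ[K] V', ∀ x y, B' (f x) (f y) = B x y := by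
  have swap : ∀ {V : Type} [AddCommGroup V] [Module K V] (B : V →ₗ[K] V →ₗ[K] K),
      (∀ x, B x x = 0) → ∀ x y, B y x = - B x y := by
    intro V _ _ B hB x y
    have h := hB (x + y)
    simp only [map_add, LinearMap.add_apply, hB] at h
    linear_combination h
  have pair : ∀ {V : Type} [AddCommGroup V] [Module K V] [FiniteDimensional K V]
      (B : V →ₗ[K] V →ₗ[K] K), (∀ x, (∀ y, B x y = 0) → x = 0) →
      0 < Module.finrank K V → ∃ x y, B x y = 1 := by
    intro V _ _ _ B hB hpos
    obtain ⟨x, hx⟩ := Module.finrank_pos_iff_exists_ne_zero.1 hpos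
    obtain ⟨y, hy⟩ : ∃ y, B x y ≠ 0 := by
      by_contra! h
      exact hx (hB x h)
    exact ⟨x, (B x y)⁻¹ • y, by simp [hy]⟩
  have perp : ∀ {V : Type} [AddCommGroup V] [Module K V] [FiniteDimensional K V]
      (B : V →ₗ[K] V →ₗ[K] K), (∀ x, B x x = 0) → (∀ x, (∀ y, B x y = 0) → x = 0) →
      ∀ x y, B x y = 1 → ∃ W : Submodule K V,
        (∀ z ∈ W, B x z = 0) ∧ (∀ z ∈ W, B y z = 0) ∧
        (∀ z, z - B z y • x - B x z • y ∈ W) ∧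
        (∀ z : W, (∀ w : W, B z w = 0) → z = 0) ∧
        Module.finrank K W + 2 = Module.finrank K V := by
    intro V _ _ _ B hB hnd x y hxy
    have hyx : B y x = -1 := by rw [swap B hB x y, hxy]
    have hmem : ∀ z, z ∈ LinearMap.ker ((B x).prod (B y)) ↔ B x z = 0 ∧ B y z = 0 := by
      intro z
      simp [LinearMap.mem_ker]
    -- The kernel is the orthogonal complement of the hyperbolic plane `⟨x, y⟩`, and this is the
    -- projection onto it along that plane.
    have hproj : ∀ z, z - B z y • x - B x z • y ∈ LinearMap.ker ((B x).prod (B y)) := by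
      intro z
      rw [hmem]
      simp [hB, hxy, hyx, swap B hB y z]
    refine ⟨LinearMap.ker ((B x).prod (B y)), fun z hz => ((hmem z).1 hz).1,
      fun z hz => ((hmem z).1 hz).2, hproj, ?_, ?_⟩
    · intro z hz
      have hz' := (hmem z).1 z.2
      refine Subtype.ext (hnd z fun u => ?_)
      have h1 := hz ⟨_, hproj u⟩
      simp only [map_sub, map_smul, smul_eq_mul] at h1
      rw [swap B hB x z, swap B hB y z, hz'.1, hz'.2] at h1
      simpa using h1
    · have h1 := LinearMap.finrank_range_add_finrank_ker ((B x).prod (B y))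
      have h2 : LinearMap.range ((B x).prod (B y)) = ⊤ := by
        rw [LinearMap.range_eq_top]
        rintro ⟨a, b⟩
        exact ⟨a • y - b • x, by simp [hB, hxy, hyx]⟩
      rw [h2, finrank_top, Module.finrank_prod, Module.finrank_self] at h1
      omega
  induction n using Nat.strong_induction_on with
  | _ n ih =>
    intro V V' _ _ _ _ _ _ B B' hB hB' hnd hnd' hn hn'
    rcases Nat.eq_zero_or_pos n with h0 | hpos
    · have : Subsingleton V := Module.finrank_zero_iff.1 (hn.trans h0)
      refine ⟨0, fun x y => ?_⟩
      rw [Subsingleton.elim x 0]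
      simp
    · obtain ⟨x, y, hxy⟩ := pair B hnd (hn ▸ hpos)
      obtain ⟨x', y', hxy'⟩ := pair B' hnd' (hn' ▸ hpos)
      obtain ⟨W, hWx, hWy, hWp, hWn, hWd⟩ := perp B hB hnd x y hxy
      obtain ⟨W', hWx', hWy', -, hWn', hWd'⟩ := perp B' hB' hnd' x' y' hxy'
      -- For `n = 1` the truncated `n - 2` does no harm: `hWd` is then contradictory.
      obtain ⟨e, he⟩ := ih (n - 2) (by omega) (B.domRestrict₁₂ W W) (B'.domRestrict₁₂ W' W')
        (fun z => hB z) (fun z => hB' z) hWn hWn' (by omega) (by omega)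
      let P : V →ₗ[K] W := LinearMap.codRestrict W
        (LinearMap.id - (B.flip y).smulRight x - (B x).smulRight y) (fun z => by simpa using hWp z)
      have hP : ∀ z, (P z : V) = z - B z y • x - B x z • y := fun z => by simp [P]
      -- The map sends `x` to `x'`, `y` to `y'`, and is `e` on `W`.
      refine ⟨(B.flip y).smulRight x' + (B x).smulRight y' + W'.subtype ∘ₗ e ∘ₗ P, fun z u => ?_⟩
      have h := he (P z) (P u)
      simp only [LinearMap.domRestrict₁₂_apply, hP] at h
      have hyx : B y x = -1 := by rw [swap B hB x y, hxy]
      have hyx' : B' y' x' = -1 := by rw [swap B' hB' x' y', hxy']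
      simp only [LinearMap.add_apply, LinearMap.smulRight_apply, LinearMap.flip_apply,
        LinearMap.comp_apply, Submodule.subtype_apply, map_add, map_smul, LinearMap.smul_apply,
        smul_eq_mul, hB', hxy', hyx', h, hWx' _ (e _).2, hWy' _ (e _).2,
        swap B' hB' x' (e (P z)), swap B' hB' y' (e (P z)), map_sub, LinearMap.sub_apply, hB,
        hxy, hyx]
      rw [swap B hB y u, swap B hB x z]
      ring

/-- Over a field, any two nondegenerate alternating forms of the same dimension are isometric. -/
theorem exists_linearEquiv_preserving_alternating {K : Type*} [Field K]
    {V V' : Type} [AddCommGroup V] [Module K V] [FiniteDimensional K V]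
    [AddCommGroup V'] [Module K V'] [FiniteDimensional K V']
    (B : V →ₗ[K] V →ₗ[K] K) (B' : V' →ₗ[K] V' →ₗ[K] K)
    (hB : ∀ x, B x x = 0) (hB' : ∀ x, B' x x = 0)
    (hnd : ∀ x, (∀ y, B x y = 0) → x = 0) (hnd' : ∀ x, (∀ y, B' x y = 0) → x = 0)
    (hd : Module.finrank K V = Module.finrank K V') :
    ∃ e : V ≃ₗ[K] V', ∀ x y, B' (e x) (e y) = B x y := by
  obtain ⟨f, hf⟩ := exists_linearMap_preserving_alternating _ B B' hB hB' hnd hnd' hd rfl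
  have hinj : Function.Injective f := by
    rw [injective_iff_map_eq_zero]
    intro x hx
    refine hnd x fun y => ?_
    rw [← hf, hx, map_zero, LinearMap.zero_apply]
  exact ⟨LinearEquiv.ofInjectiveOfFinrankEq f hinj hd, fun x y => hf x y⟩

/-! ### Integral powers of rational matrices -/

/-- A rational matrix annihilated by a monic integer polynomial with unit constant coefficient has
a power with integer entries. -/
theorem exists_pow_eq_map_intCast {ι : Type*} [Fintype ι] [DecidableEq ι] (A : Matrix ι ι ℚ)
    (m : ℤ[X]) (hm : m.Monic) (hm0 : IsUnit (m.coeff 0)) (hA : aeval A m = 0) :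
    ∃ k : ℕ, 0 < k ∧ ∃ M : Matrix ι ι ℤ, A ^ k = M.map (Int.cast : ℤ → ℚ) := by
  by_cases hm1 : m = 1
  · have : Subsingleton (Matrix ι ι ℚ) :=
      subsingleton_of_zero_eq_one (by rw [← hA, hm1, map_one])
    exact ⟨1, one_pos, 0, Subsingleton.elim _ _⟩
  -- `N` is a common denominator of the powers of `A` below the degree of `m`.
  obtain ⟨N, hN⟩ := IsLocalization.exist_integer_multiples_of_finset (nonZeroDivisors ℤ)
    (Finset.univ.image fun x : Fin m.natDegree × ι × ι => (A ^ (x.1 : ℕ)) x.2.1 x.2.2)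
  set d : ℕ := (N : ℤ).natAbs with hd
  have hN0 : (N : ℤ) ≠ 0 := nonZeroDivisors.coe_ne_zero N
  have hd0 : d ≠ 0 := Int.natAbs_ne_zero.2 hN0
  have : NeZero d := ⟨hd0⟩
  -- `R = (ℤ/d)[X]/(m)` is a finite ring where `X` is a unit, since `X` divides the unit `m(0)`
  -- there. Hence `Xᵏ = 1` in `R` for some `k > 0`.
  set R := AdjoinRoot (m.map (Int.castRingHom (ZMod d)))
  have hmm : (m.map (Int.castRingHom (ZMod d))).Monic := hm.map _
  have : Module.Finite (ZMod d) R := hmm.finite_adjoinRoot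
  have : Finite R := Module.finite_of_finite (ZMod d)
  have hu : IsUnit (AdjoinRoot.root (m.map (Int.castRingHom (ZMod d)))) := by
    have h := AdjoinRoot.mk_self (f := m.map (Int.castRingHom (ZMod d)))
    conv at h => enter [1, 2]; rw [← m.divX_mul_X_add]
    simp only [Polynomial.map_add, Polynomial.map_mul, Polynomial.map_X, Polynomial.map_C, map_add,
      map_mul, AdjoinRoot.mk_X, AdjoinRoot.mk_C] at h
    have h2 : IsUnit (AdjoinRoot.of (m.map (Int.castRingHom (ZMod d)))
        (Int.castRingHom (ZMod d) (m.coeff 0))) := (hm0.map _).map _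
    rw [← IsUnit.neg_iff, ← eq_neg_of_add_eq_zero_left h] at h2
    exact isUnit_of_mul_isUnit_right h2
  obtain ⟨u, hu⟩ := hu
  obtain ⟨k, hk, hku⟩ := isOfFinOrder_iff_pow_eq_one.1 (isOfFinOrder_of_finite u)
  have hdvd : m.map (Int.castRingHom (ZMod d)) ∣
      ((X ^ k - 1 : ℤ[X]).map (Int.castRingHom (ZMod d))) := by
    rw [← AdjoinRoot.mk_eq_zero]
    have := congrArg Units.val hku
    rw [Units.val_pow_eq_pow_val, hu, Units.val_one] at this
    simp [this]
  rw [← Polynomial.modByMonic_eq_zero_iff_dvd hmm, ← Polynomial.map_modByMonic _ hm] at hdvd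
  set b := (X ^ k - 1 : ℤ[X]) %ₘ m with hb
  -- The remainder `b` has degree below that of `m` and coefficients divisible by `d`, so they clear
  -- all denominators in `b(A)`.
  have hAk : A ^ k = 1 + aeval A b := by
    have h := congrArg (aeval A) (Polynomial.modByMonic_add_div (X ^ k - 1 : ℤ[X]) m)
    simp only [map_add, map_mul, hA, zero_mul, add_zero, map_sub, map_pow, aeval_X, map_one] at h
    rw [← hb] at h
    rw [h, add_sub_cancel]
  have hint : A ^ k ∈ ((Int.castRingHom ℚ).mapMatrix : Matrix ι ι ℤ →+* Matrix ι ι ℚ).range := by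
    rw [hAk, Polynomial.aeval_eq_sum_range]
    refine add_mem (one_mem _) (sum_mem fun i _ => ?_)
    by_cases hi : i < m.natDegree
    · have hbi : (d : ℤ) ∣ b.coeff i := by
        have := congrArg (fun q => q.coeff i) hdvd
        simpa [ZMod.intCast_zmod_eq_zero_iff_dvd] using this
      obtain ⟨c, hc⟩ : (N : ℤ) ∣ b.coeff i := by
        rwa [hd, Int.natAbs_dvd] at hbi
      have hent : ∀ r s, ∃ z : ℤ, (z : ℚ) = (N : ℤ) * (A ^ i) r s := by
        intro r s
        obtain ⟨z, hz⟩ := hN ((A ^ i) r s)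
          (Finset.mem_image.2 ⟨(⟨i, hi⟩, r, s), Finset.mem_univ _, rfl⟩)
        exact ⟨z, by simpa using! hz⟩
      choose E hE using hent
      refine ⟨Matrix.of fun r s => c * E r s, ?_⟩
      ext r s
      simp [hc, hE]
      ring
    · rw [Polynomial.coeff_eq_zero_of_natDegree_lt, zero_smul]
      · exact zero_mem _
      · refine lt_of_lt_of_le (Polynomial.natDegree_modByMonic_lt _ hm hm1) (not_lt.1 hi)
  obtain ⟨M, hM⟩ := hint
  exact ⟨k, hk, M, by rw [← hM]; rfl⟩

/-! ### Asymptotics of powers with a dominant eigenvalue -/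

section

attribute [local instance] Matrix.linftyOpNormedRing Matrix.linftyOpNormedAlgebra

/-- Powers of a complex matrix all of whose eigenvalues lie in the open unit disc tend to `0`. -/
theorem tendsto_pow_zero_of_spectrum {ι : Type*} [Fintype ι] [DecidableEq ι] [Nonempty ι]
    (B : Matrix ι ι ℂ) (hB : ∀ μ ∈ spectrum ℂ B, ‖μ‖ < 1) :
    Filter.Tendsto (fun k : ℕ => B ^ k) Filter.atTop (nhds 0) := by
  have hr : spectralRadius ℂ B < 1 := by
    have := spectrum.spectralRadius_lt_of_forall_lt B (r := 1) (fun k hk => by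
      exact_mod_cast hB k hk)
    simpa using this
  obtain ⟨r, hr1, hr2⟩ := ENNReal.lt_iff_exists_nnreal_btwn.1 hr
  have hr2' : r < 1 := by exact_mod_cast hr2
  -- Gelfand's formula gives `‖Bᵏ‖ < rᵏ` eventually, with `r < 1`.
  have h := spectrum.pow_nnnorm_pow_one_div_tendsto_nhds_spectralRadius B
  have hev := h.eventually (gt_mem_nhds hr1)
  refine tendsto_zero_iff_norm_tendsto_zero.2 ?_
  refine squeeze_zero' (Filter.Eventually.of_forall fun k => norm_nonneg _) ?_
    (tendsto_pow_atTop_nhds_zero_of_lt_one r.2 hr2')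
  filter_upwards [hev, Filter.eventually_gt_atTop 0] with k hk hk0
  have h2 := ENNReal.rpow_lt_rpow hk (show (0 : ℝ) < k by exact_mod_cast hk0)
  rw [← ENNReal.rpow_mul, one_div, inv_mul_cancel₀ (by positivity), ENNReal.rpow_one,
    ENNReal.rpow_natCast] at h2
  exact_mod_cast h2.le

end

theorem mem_spectrum_iff_exists_vecMul {ι F : Type*} [Fintype ι] [DecidableEq ι] [Field F] {B :
    Matrix ι ι F} {μ : F} :
    μ ∈ spectrum F B ↔ ∃ x : ι → F, x ≠ 0 ∧ x ᵥ* B = μ • x := by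
  rw [spectrum.mem_iff, Matrix.isUnit_iff_isUnit_det, isUnit_iff_ne_zero, not_not,
    ← Matrix.exists_vecMul_eq_zero_iff]
  refine exists_congr fun x => and_congr_right fun _ => ?_
  rw [Matrix.vecMul_sub, sub_eq_zero, Algebra.algebraMap_eq_smul_one, Matrix.vecMul_smul,
    Matrix.vecMul_one, eq_comm]

/-- A real matrix with a dominant simple real eigenvalue `lam`, with right eigenvector `v` and left
eigenvector `w` normalised by `w ⬝ᵥ v = 1`, satisfies `lam⁻ᵏ Aᵏ → v wᵀ`. -/
theorem tendsto_pow_dominant {ι : Type*} [Fintype ι] [DecidableEq ι]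
    (A : Matrix ι ι ℝ) (lam : ℝ) (hlam : lam ≠ 0) (v w : ι → ℝ)
    (hv : A *ᵥ v = lam • v) (hw : w ᵥ* A = lam • w) (hwv : w ⬝ᵥ v = 1)
    (hdom : ∀ (μ : ℂ) (x : ι → ℂ), x ≠ 0 → x ᵥ* A.map ((↑) : ℝ → ℂ) = μ • x →
      (∃ c : ℂ, x = c • fun i => (w i : ℂ)) ∨ ‖μ‖ < |lam|) (i j : ι) :
    Filter.Tendsto (fun k : ℕ => (lam ^ k)⁻¹ * (A ^ k) i j) Filter.atTop (nhds (v i * w j)) := by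
  have : Nonempty ι := ⟨i⟩
  -- `E` is the spectral projection for `lam` and `D` the rest of `lam⁻¹A`; as `DE = ED = 0`,
  -- positive powers split. The exponent 0 would fail.
  set E := Matrix.vecMulVec v w with hE
  have hEE : E * E = E := by
    rw [hE, Matrix.vecMulVec_mul_vecMulVec, hwv, one_smul]
  have hAE : A * E = lam • E := by
    rw [hE, Matrix.mul_vecMulVec, hv, Matrix.smul_vecMulVec]
  have hEA : E * A = lam • E := by
    rw [hE, Matrix.vecMulVec_mul, hw, Matrix.vecMulVec_smul]
  set D := lam⁻¹ • A - E with hD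
  have hDE : D * E = 0 := by
    rw [hD, sub_mul, hEE, smul_mul_assoc, hAE, smul_smul, inv_mul_cancel₀ hlam, one_smul, sub_self]
  have hED : E * D = 0 := by
    rw [hD, mul_sub, hEE, mul_smul_comm, hEA, smul_smul, inv_mul_cancel₀ hlam, one_smul, sub_self]
  have hpow : ∀ k : ℕ, (lam⁻¹ • A) ^ (k + 1) = D ^ (k + 1) + E := by
    intro k
    have hs : lam⁻¹ • A = D + E := by rw [hD, sub_add_cancel]
    rw [hs]
    induction k with
    | zero => simp
    | succ k ih =>
      rw [pow_succ, ih, add_mul, mul_add, mul_add, hED, hEE, pow_succ D k, mul_assoc, mul_assoc,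
        hDE, mul_zero, add_zero, zero_add, pow_succ, pow_succ, mul_assoc]
  have hDc : Filter.Tendsto (fun k : ℕ => (D.map ((↑) : ℝ → ℂ)) ^ k) Filter.atTop (nhds 0) := by
    refine tendsto_pow_zero_of_spectrum _ fun μ hμ => ?_
    by_cases hμ0 : μ = 0
    · simp [hμ0]
    obtain ⟨x, hx0, hx⟩ := mem_spectrum_iff_exists_vecMul.1 hμ
    -- A left eigenvector of `D` with `μ ≠ 0` is orthogonal to `v`. So it is an eigenvector of `A`
    -- for `lam * μ`, and no multiple of `w`, because `w ⬝ᵥ v = 1`.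
    have hv1 : x ⬝ᵥ (fun i => (v i : ℂ)) = 0 := by
      have h1 : D *ᵥ v = 0 := by
        rw [hD, Matrix.sub_mulVec, Matrix.smul_mulVec, hv, hE, Matrix.vecMulVec_mulVec, hwv]
        simp [smul_smul, hlam]
      have h2 : D.map ((↑) : ℝ → ℂ) *ᵥ (fun i => (v i : ℂ)) = 0 := by
        have := Complex.ofRealHom.map_mulVec D v
        ext i
        have := this i
        rw [h1] at this
        simpa using! this.symm
      have h3 : μ * (x ⬝ᵥ (fun i => (v i : ℂ))) = 0 := by
        rw [← smul_eq_mul, ← smul_dotProduct, ← hx, ← Matrix.dotProduct_mulVec, h2, dotProduct_zero]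
      exact (mul_eq_zero.1 h3).resolve_left hμ0
    have hxA : x ᵥ* A.map ((↑) : ℝ → ℂ) = (lam * μ) • x := by
      have hA : A.map ((↑) : ℝ → ℂ) = (lam : ℂ) • (D.map ((↑) : ℝ → ℂ) +
          Matrix.vecMulVec (fun i => (v i : ℂ)) (fun i => (w i : ℂ))) := by
        ext i j
        have : (lam : ℂ) ≠ 0 := by exact_mod_cast hlam
        simp [hD, hE, Matrix.vecMulVec_apply]
        field_simp
      rw [hA, Matrix.vecMul_smul, Matrix.vecMul_add, hx, Matrix.vecMul_vecMulVec, hv1, zero_smul,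
        add_zero, smul_smul]
    rcases hdom _ x hx0 hxA with ⟨c, hc⟩ | h
    · exfalso
      apply hx0
      rw [hc, smul_dotProduct, smul_eq_mul] at hv1
      have h1 : (fun i => (w i : ℂ)) ⬝ᵥ (fun i => (v i : ℂ)) = 1 := by
        have := congrArg ((↑) : ℝ → ℂ) hwv
        simpa [dotProduct] using this
      rw [h1, mul_one] at hv1
      rw [hc, hv1, zero_smul]
    · rw [norm_mul, Complex.norm_real, Real.norm_eq_abs] at h
      have : 0 < |lam| := abs_pos.2 hlam
      nlinarith
  have hDr : Filter.Tendsto (fun k : ℕ => (D ^ k) i j) Filter.atTop (nhds 0) := by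
    have h1 : Filter.Tendsto (fun k : ℕ => ((D.map ((↑) : ℝ → ℂ)) ^ k) i j) Filter.atTop
        (nhds ((0 : Matrix ι ι ℂ) i j)) :=
      ((continuous_id.matrix_elem i j).tendsto _).comp hDc
    have h2 : ∀ k : ℕ, ((D.map ((↑) : ℝ → ℂ)) ^ k) i j = (((D ^ k) i j : ℝ) : ℂ) := by
      intro k
      have := Matrix.map_pow D Complex.ofRealHom k
      exact (congrFun (congrFun this i) j).symm
    simp only [h2] at h1
    have := (Complex.continuous_re.tendsto _).comp h1
    simpa [Function.comp_def] using this
  have hlim : Filter.Tendsto (fun k : ℕ => (D ^ (k + 1)) i j + E i j) Filter.atTop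
      (nhds (v i * w j)) := by
    have := ((Filter.tendsto_add_atTop_iff_nat 1).2 hDr).add_const (E i j)
    simpa [hE, Matrix.vecMulVec_apply] using this
  rw [← Filter.tendsto_add_atTop_iff_nat 1]
  refine hlim.congr fun k => ?_
  have := congrFun (congrFun (hpow k) i) j
  rw [_root_.smul_pow, Matrix.smul_apply, smul_eq_mul, inv_pow] at this
  rw [this, Matrix.add_apply]

/-! ### Transvections and positivity of hyperbolic pairs -/

/-- The symplectic transvection `x ↦ x + c (aᵀ L x) a` of the form with Gram matrix `L`. -/
def transvection {ι R : Type*} [Fintype ι] [DecidableEq ι] [CommRing R] (L : Matrix ι ι R)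
    (c : R) (a : ι → R) : Matrix ι ι R :=
  1 + c • vecMulVec a (a ᵥ* L)

section

variable {ι R : Type*} [Fintype ι]

theorem dotProduct_mulVec_swap [CommRing R] {L : Matrix ι ι R} (hL : Lᵀ = -L) (x y : ι → R) :
    x ⬝ᵥ L *ᵥ y = -(y ⬝ᵥ L *ᵥ x) := by
  rw [dotProduct_mulVec, dotProduct_comm, ← mulVec_transpose, hL, neg_mulVec, dotProduct_neg]

theorem dotProduct_mulVec_self_eq_zero [CommRing R] [NoZeroDivisors R] [CharZero R]
    {L : Matrix ι ι R} (hL : Lᵀ = -L) (x : ι → R) : x ⬝ᵥ L *ᵥ x = 0 :=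
  self_eq_neg.1 (dotProduct_mulVec_swap hL x x)

variable [DecidableEq ι]

theorem transvection_mulVec [CommRing R] (L : Matrix ι ι R) (c : R) (a x : ι → R) :
    transvection L c a *ᵥ x = x + (c * (a ⬝ᵥ L *ᵥ x)) • a := by
  ext i
  simp [transvection, add_mulVec, smul_mulVec, vecMulVec_mulVec, dotProduct_mulVec]
  ring

theorem transvection_preserves [CommRing R] [NoZeroDivisors R] [CharZero R]
    {L : Matrix ι ι R} (hL : Lᵀ = -L) (c : R) (a : ι → R) :
    (transvection L c a)ᵀ * L * transvection L c a = L := by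
  have h2 : L *ᵥ a = -(a ᵥ* L) := by
    rw [← mulVec_transpose, hL, neg_mulVec, neg_neg]
  simp only [transvection, transpose_add, transpose_one, transpose_smul, transpose_vecMulVec,
    add_mul, mul_add, one_mul, mul_one, Matrix.smul_mul, Matrix.mul_smul, vecMulVec_mul,
      mul_vecMulVec, h2,
    neg_vecMulVec]
  simp [smul_mulVec, vecMulVec_mulVec, ← dotProduct_mulVec, dotProduct_mulVec_self_eq_zero hL]

/-- No hyperplane contains the open positive cone: if the all-ones vector lies in it, raising one
coordinate where `y` is nonzero leaves it. -/
theorem exists_pos_dotProduct_ne_zero {y : ι → ℝ} (hy : y ≠ 0) :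
    ∃ x : ι → ℝ, (∀ i, 0 < x i) ∧ y ⬝ᵥ x ≠ 0 := by
  by_cases h : y ⬝ᵥ (fun _ => 1) = 0
  · obtain ⟨i, hi⟩ := Function.ne_iff.1 hy
    refine ⟨(fun _ => 1) + Pi.single i 1, fun j => ?_, ?_⟩
    · have : (0 : ℝ) ≤ (Pi.single i 1 : ι → ℝ) j := by
        by_cases hj : j = i
        · subst hj; simp
        · simp [hj]
      simp only [Pi.add_apply]
      linarith
    · rw [dotProduct_add, h, zero_add, dotProduct_single, mul_one]
      exact hi
  · exact ⟨_, fun _ => one_pos, h⟩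

/-- Two transvections move a hyperbolic pair to a pair `(v, u)` such that both `v` and `L u` have
positive entries. -/
theorem exists_transvections_pos {L : Matrix ι ι ℝ} (hL : Lᵀ = -L) (hdet : IsUnit L.det)
    (v u : ι → ℝ) (hvu : v ⬝ᵥ L *ᵥ u = 1) :
    ∃ (c₁ : ℝ) (a₁ : ι → ℝ) (c₂ : ℝ) (a₂ : ι → ℝ),
      (∀ i, 0 < ((transvection L c₂ a₂ * transvection L c₁ a₁) *ᵥ v) i) ∧
      (∀ i, 0 < (L *ᵥ ((transvection L c₂ a₂ * transvection L c₁ a₁) *ᵥ u)) i) := by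
  have hLv : L *ᵥ v ≠ 0 := by
    intro h
    rw [dotProduct_mulVec_swap hL, h] at hvu
    simp at hvu
  obtain ⟨v', hv', hv'0⟩ := exists_pos_dotProduct_ne_zero hLv
  rw [dotProduct_comm] at hv'0
  -- This scalar makes the transvection along `v' - v` carry `v` exactly to `v'`.
  set c₁ := (v' ⬝ᵥ L *ᵥ v)⁻¹ with hc₁
  have h1 : transvection L c₁ (v' - v) *ᵥ v = v' := by
    rw [transvection_mulVec, sub_dotProduct, dotProduct_mulVec_self_eq_zero hL, sub_zero, hc₁,
      inv_mul_cancel₀ hv'0, one_smul, add_sub_cancel]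
  set u₁ := transvection L c₁ (v' - v) *ᵥ u with hu₁
  have hvu₁ : v' ⬝ᵥ L *ᵥ u₁ = 1 := by
    rw [← hvu, ← h1, hu₁]
    conv_rhs => rw [← transvection_preserves hL c₁ (v' - v)]
    rw [← mulVec_mulVec, ← mulVec_mulVec, dotProduct_mulVec v, vecMul_transpose]
  have hu₁0 : u₁ ≠ 0 := by
    intro h
    rw [h] at hvu₁
    simp at hvu₁
  obtain ⟨w, hw, hw0⟩ := exists_pos_dotProduct_ne_zero hu₁0
  have hne : Nonempty ι := by
    by_contra h
    rw [not_nonempty_iff] at h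
    exact hw0 (by simp)
  have hpos : 0 < v' ⬝ᵥ w :=
    Finset.sum_pos (fun i _ => mul_pos (hv' i) (hw i)) Finset.univ_nonempty
  -- `u'` has `L u'` positive and the same pairing with `v'` as `u₁`. Hence `u' - u₁` is orthogonal
  -- to `v'`, and the second transvection fixes `v'`. The choice of `w` makes `c₂` defined.
  set u' := L⁻¹ *ᵥ ((v' ⬝ᵥ w)⁻¹ • w) with hu'
  have hLu' : L *ᵥ u' = (v' ⬝ᵥ w)⁻¹ • w := by
    rw [hu', mulVec_mulVec, mul_nonsing_inv _ hdet, one_mulVec]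
  have hvu' : v' ⬝ᵥ L *ᵥ u' = 1 := by
    rw [hLu', dotProduct_smul, smul_eq_mul, inv_mul_cancel₀ hpos.ne']
  have huu' : u' ⬝ᵥ L *ᵥ u₁ ≠ 0 := by
    rw [dotProduct_mulVec_swap hL, hLu', dotProduct_smul, smul_eq_mul]
    exact neg_ne_zero.2 (mul_ne_zero (inv_ne_zero hpos.ne') hw0)
  set c₂ := (u' ⬝ᵥ L *ᵥ u₁)⁻¹ with hc₂
  have h2 : transvection L c₂ (u' - u₁) *ᵥ u₁ = u' := by
    rw [transvection_mulVec, sub_dotProduct, dotProduct_mulVec_self_eq_zero hL, sub_zero, hc₂,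
      inv_mul_cancel₀ huu', one_smul, add_sub_cancel]
  have h3 : transvection L c₂ (u' - u₁) *ᵥ v' = v' := by
    rw [transvection_mulVec, dotProduct_mulVec_swap hL, mulVec_sub, dotProduct_sub, hvu', hvu₁]
    simp
  refine ⟨c₁, v' - v, c₂, u' - u₁, fun i => ?_, fun i => ?_⟩
  · rw [← mulVec_mulVec, h1, h3]
    exact hv' i
  · rw [← mulVec_mulVec, ← hu₁, h2, hLu']
    exact mul_pos (inv_pos.2 hpos) (hw i)

theorem transvection_map {S : Type*} [CommRing R] [CommRing S] (f : R →+* S) (L : Matrix ι ι R)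
    (c : R) (a : ι → R) :
    (transvection L c a).map f = transvection (L.map f) (f c) (f ∘ a) := by
  ext i j
  have := f.map_vecMul L a j
  simp [transvection, Matrix.one_apply, vecMulVec_apply, this, apply_ite f]

/-- A rational symplectic matrix moves a real hyperbolic pair to a pair `(v, u)` such that both `v`
and `L u` have positive entries. -/
theorem exists_rational_symplectic_pos {L : Matrix ι ι ℚ} (hL : Lᵀ = -L) (hdet : IsUnit L.det)
    (v u : ι → ℝ) (hvu : v ⬝ᵥ L.map ((↑) : ℚ → ℝ) *ᵥ u = 1) :
    ∃ G : Matrix ι ι ℚ, Gᵀ * L * G = L ∧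
      (∀ i, 0 < (G.map ((↑) : ℚ → ℝ) *ᵥ v) i) ∧
      (∀ i, 0 < (L.map ((↑) : ℚ → ℝ) *ᵥ (G.map ((↑) : ℚ → ℝ) *ᵥ u)) i) := by
  set L' := L.map ((↑) : ℚ → ℝ) with hL'
  have hL'' : L'ᵀ = -L' := by
    ext i j
    have := congrFun (congrFun hL i) j
    simp only [transpose_apply] at this
    simp [hL', this]
  have hdet' : IsUnit L'.det := by
    have := hdet.map (Rat.castHom ℝ)
    rwa [RingHom.map_det] at this
  let F : (ℝ × (ι → ℝ)) × (ℝ × (ι → ℝ)) → Matrix ι ι ℝ := fun p =>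
    transvection L' p.2.1 p.2.2 * transvection L' p.1.1 p.1.2
  have hF : Continuous F := by
    unfold F transvection
    refine Continuous.matrix_mul ?_ ?_
    · exact continuous_const.add (continuous_snd.fst.smul (continuous_snd.snd.matrix_vecMulVec
        (continuous_snd.snd.matrix_vecMul continuous_const)))
    · exact continuous_const.add (continuous_fst.fst.smul (continuous_fst.snd.matrix_vecMulVec
        (continuous_fst.snd.matrix_vecMul continuous_const)))
  -- Good parameters of the two transvections form a nonempty open set, which therefore has a
  -- rational point.
  let U : Set ((ℝ × (ι → ℝ)) × (ℝ × (ι → ℝ))) :=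
    {p | (∀ i, 0 < (F p *ᵥ v) i) ∧ ∀ i, 0 < (L' *ᵥ (F p *ᵥ u)) i}
  have hU : IsOpen U := by
    simp only [U, Set.ofPred_and, Set.ofPred_forall]
    have hc1 : Continuous fun p => F p *ᵥ v := hF.matrix_mulVec continuous_const
    have hc2 : Continuous fun p => L' *ᵥ (F p *ᵥ u) :=
      continuous_const.matrix_mulVec (hF.matrix_mulVec continuous_const)
    exact (isOpen_iInter_of_finite fun i => isOpen_lt continuous_const
      ((continuous_apply i).comp hc1)).inter (isOpen_iInter_of_finite fun i =>
      isOpen_lt continuous_const ((continuous_apply i).comp hc2))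
  have hUne : U.Nonempty := by
    obtain ⟨c₁, a₁, c₂, a₂, h1, h2⟩ := exists_transvections_pos hL'' hdet' v u hvu
    exact ⟨((c₁, a₁), (c₂, a₂)), h1, h2⟩
  have hd1 : DenseRange (Prod.map ((↑) : ℚ → ℝ) (Pi.map fun _ : ι => ((↑) : ℚ → ℝ))) :=
    Rat.denseRange_cast.prodMap (DenseRange.piMap fun _ => Rat.denseRange_cast)
  obtain ⟨q, hq⟩ := (hd1.prodMap hd1).exists_mem_open hU hUne
  have hG : (transvection L q.2.1 q.2.2 * transvection L q.1.1 q.1.2).map ((↑) : ℚ → ℝ) =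
      F (Prod.map (Prod.map ((↑) : ℚ → ℝ) (Pi.map fun _ : ι => ((↑) : ℚ → ℝ)))
        (Prod.map ((↑) : ℚ → ℝ) (Pi.map fun _ : ι => ((↑) : ℚ → ℝ))) q) := by
    have h1 := Matrix.map_mul (f := Rat.castHom ℝ) (L := transvection L q.2.1 q.2.2)
      (M := transvection L q.1.1 q.1.2)
    rw [transvection_map, transvection_map] at h1
    exact h1
  refine ⟨transvection L q.2.1 q.2.2 * transvection L q.1.1 q.1.2, ?_, ?_⟩
  · have h1 := transvection_preserves hL q.1.1 q.1.2
    have h2 := transvection_preserves hL q.2.1 q.2.2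
    rw [transpose_mul]
    calc _ = (transvection L q.1.1 q.1.2)ᵀ * ((transvection L q.2.1 q.2.2)ᵀ * L *
          transvection L q.2.1 q.2.2) * transvection L q.1.1 q.1.2 := by
          simp only [Matrix.mul_assoc]
      _ = L := by rw [h2, h1]
  · rw [hG]
    exact hq

end

/-! ### Eigenvectors, symplectic conjugation and spectral radius -/

section

variable {ι : Type*} [Fintype ι] [DecidableEq ι]

theorem vecMul_aeval {S F : Type*} [CommRing S] [CommRing F] [Algebra S F] {A : Matrix ι ι F}
    {μ : F} {x : ι → F} (h : x ᵥ* A = μ • x) (p : S[X]) :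
    x ᵥ* aeval A p = aeval μ p • x := by
  induction p using Polynomial.induction_on' with
  | add p q hp hq => rw [map_add, map_add, vecMul_add, hp, hq, add_smul]
  | monomial n a =>
    have hpow : x ᵥ* A ^ n = μ ^ n • x := by
      induction n with
      | zero => simp
      | succ n ih => rw [pow_succ, ← vecMul_vecMul, ih, smul_vecMul, h, smul_smul, pow_succ]
    rw [aeval_monomial, aeval_monomial, ← vecMul_vecMul, Algebra.algebraMap_eq_smul_one,
      vecMul_smul, vecMul_one, smul_vecMul, hpow, ← smul_smul, algebraMap_smul]

theorem aeval_mul_of_semiconj {S A : Type*} [CommRing S] [Ring A] [Algebra S A] {a b g : A}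
    (h : b * g = g * a) (p : S[X]) : aeval b p * g = g * aeval a p := by
  induction p using Polynomial.induction_on' with
  | add p q hp hq => rw [map_add, map_add, add_mul, mul_add, hp, hq]
  | monomial n r =>
    have hpow : b ^ n * g = g * a ^ n := by
      induction n with
      | zero => simp
      | succ n ih => rw [pow_succ, mul_assoc, h, ← mul_assoc, ih, mul_assoc, ← pow_succ]
    rw [aeval_monomial, aeval_monomial, mul_assoc, hpow, ← mul_assoc, Algebra.commutes, mul_assoc]

/-- A left eigenvector for an eigenvalue that is a simple root of an annihilating polynomial pairs
nontrivially with some right eigenvector. -/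
theorem exists_mulVec_eq_smul_dotProduct_eq_one {A : Matrix ι ι ℝ} {m : ℤ[X]} (hA : aeval A m = 0)
    {lam : ℝ} (hm : aeval lam m = 0) (hm' : aeval lam (derivative m) ≠ 0)
    {w : ι → ℝ} (hw0 : w ≠ 0) (hw : w ᵥ* A = lam • w) :
    ∃ v : ι → ℝ, A *ᵥ v = lam • v ∧ v ⬝ᵥ w = 1 := by
  have hmR : (m.map (Int.castRingHom ℝ)).IsRoot lam := by
    rw [IsRoot, eval_map, ← algebraMap_int_eq, ← aeval_def, hm]
  obtain ⟨r, hr⟩ := dvd_iff_isRoot.2 hmR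
  -- Here `m = (X - lam) r` and `r(lam) = m'(lam) ≠ 0`. The columns of `r(A)` are
  -- `lam`-eigenvectors, and `w r(A) = r(lam) w`, so `r(A) w` pairs nontrivially with `w`.
  have hr0 : aeval lam r ≠ 0 := by
    have h := congrArg (fun q => eval lam (derivative q)) hr
    simp only [derivative_map, derivative_mul, eval_add, eval_mul, derivative_sub, derivative_X,
      derivative_C, sub_zero, one_mul, eval_sub, eval_X, eval_C, sub_self, zero_mul,
      add_zero] at h
    rw [eval_map, ← algebraMap_int_eq, ← aeval_def] at h
    rwa [h] at hm'
  have hAr : A * aeval A r = lam • aeval A r := by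
    have h := congrArg (aeval A) hr
    rw [← algebraMap_int_eq, aeval_map_algebraMap, hA] at h
    simp only [map_mul, map_sub, aeval_X, aeval_C, sub_mul, Algebra.algebraMap_eq_smul_one,
      smul_mul_assoc, one_mul] at h
    exact (sub_eq_zero.1 h.symm)
  have hww : w ⬝ᵥ w ≠ 0 := by
    rwa [Ne, dotProduct_self_eq_zero]
  refine ⟨(aeval lam r * (w ⬝ᵥ w))⁻¹ • (aeval A r *ᵥ w), ?_, ?_⟩
  · rw [mulVec_smul, mulVec_mulVec, hAr, smul_mulVec, smul_comm]
  · rw [smul_dotProduct, dotProduct_comm (_ *ᵥ _), dotProduct_mulVec, vecMul_aeval hw,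
    smul_dotProduct,
      smul_eq_mul, smul_eq_mul, inv_mul_cancel₀ (mul_ne_zero hr0 hww)]

theorem aeval_int_ringHom_apply {R S : Type*} [Ring R] [Ring S] [Algebra ℤ R] [Algebra ℤ S]
    (f : R →+* S) (a : R) (m : ℤ[X]) : aeval (f a) m = f (aeval a m) := by
  have hc : ∀ z, f (algebraMap ℤ R z) = algebraMap ℤ S z := fun z =>
    RingHom.congr_fun (Subsingleton.elim (f.comp (algebraMap ℤ R)) (algebraMap ℤ S)) z
  exact aeval_algHom_apply (AlgHom.mk f hc) a m

theorem aeval_map_ringHom {F E : Type*} [CommRing F] [CommRing E] (f : F →+* E) (A : Matrix ι ι F)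
    (m : ℤ[X]) : aeval (A.map f) m = (aeval A m).map f :=
  aeval_int_ringHom_apply (f.mapMatrix : Matrix ι ι F →+* Matrix ι ι E) A m

/-- A rational symplectic matrix can be conjugated to one whose dominant right and left
eigenvectors are positive. -/
theorem exists_symplectic_conj_pos_eigenvectors {L A : Matrix ι ι ℚ} (hL : Lᵀ = -L)
    (hdet : IsUnit L.det) (hAL : Aᵀ * L * A = L) {m : ℤ[X]} (hA : aeval A m = 0) {lam : ℝ}
    (hm : aeval lam m = 0) (hm' : aeval lam (derivative m) ≠ 0) {w : ι → ℝ} (hw0 : w ≠ 0)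
    (hw : w ᵥ* A.map ((↑) : ℚ → ℝ) = lam • w)
    (huniq : ∀ x : ι → ℂ, x ᵥ* A.map ((↑) : ℚ → ℂ) = (lam : ℂ) • x →
      ∃ c : ℂ, x = c • fun i => (w i : ℂ)) :
    ∃ (B : Matrix ι ι ℚ) (v' w' : ι → ℝ), Bᵀ * L * B = L ∧ aeval B m = 0 ∧
      B.map ((↑) : ℚ → ℝ) *ᵥ v' = lam • v' ∧ w' ᵥ* B.map ((↑) : ℚ → ℝ) = lam • w' ∧
      w' ⬝ᵥ v' = 1 ∧ (∀ i, 0 < v' i) ∧ (∀ i, 0 < w' i) ∧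
      (∀ x : ι → ℂ, x ᵥ* B.map ((↑) : ℚ → ℂ) = (lam : ℂ) • x →
        ∃ c : ℂ, x = c • fun i => (w' i : ℂ)) := by
  have hAR : aeval (A.map ((↑) : ℚ → ℝ)) m = 0 := by
    have := aeval_map_ringHom (Rat.castHom ℝ) A m
    rw [hA] at this
    simpa using! this
  obtain ⟨v, hv, hvw⟩ := exists_mulVec_eq_smul_dotProduct_eq_one hAR hm hm' hw0 hw
  have hdetR : IsUnit (L.map ((↑) : ℚ → ℝ)).det := by
    have := hdet.map (Rat.castHom ℝ)
    rwa [RingHom.map_det] at this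
  have hLu : L.map ((↑) : ℚ → ℝ) *ᵥ ((L.map ((↑) : ℚ → ℝ))⁻¹ *ᵥ w) = w := by
    rw [mulVec_mulVec, mul_nonsing_inv _ hdetR, one_mulVec]
  obtain ⟨G, hG, hGv, hGw⟩ := exists_rational_symplectic_pos hL hdet v
    ((L.map ((↑) : ℚ → ℝ))⁻¹ *ᵥ w) (by rw [hLu, hvw])
  set w' := L.map ((↑) : ℚ → ℝ) *ᵥ (G.map ((↑) : ℚ → ℝ) *ᵥ ((L.map ((↑) : ℚ → ℝ))⁻¹ *ᵥ w)) with hw'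
  have hGu : IsUnit G.det := by
    have h := congrArg Matrix.det hG
    rw [det_mul, det_mul] at h
    rw [← h] at hdet
    exact isUnit_of_mul_isUnit_right hdet
  obtain ⟨B, hB⟩ : ∃ B, B = G * A * G⁻¹ := ⟨_, rfl⟩
  have hBG : B * G = G * A := by
    rw [hB, Matrix.mul_assoc, nonsing_inv_mul _ hGu, Matrix.mul_one]
  have hcan : ∀ X Y : Matrix ι ι ℚ, X * G = Y * G → X = Y := by
    intro X Y h
    have := congrArg (· * G⁻¹) h
    simpa [Matrix.mul_assoc, mul_nonsing_inv _ hGu] using this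
  have hmapmul : ∀ {E : Type} [Field E] [CharZero E] (X Y : Matrix ι ι ℚ),
      (X * Y).map ((↑) : ℚ → E) = X.map ((↑) : ℚ → E) * Y.map ((↑) : ℚ → E) := by
    intro E _ _ X Y
    exact Matrix.map_mul (f := Rat.castHom E)
  -- Since `G` preserves `L`, `w' = L G L⁻¹ w` equals `w G⁻¹` as a row, the left eigenvector of `G A
  -- G⁻¹`.
  have hwG : w' ᵥ* G.map ((↑) : ℚ → ℝ) = w := by
    rw [hw', ← mulVec_transpose, mulVec_mulVec, mulVec_mulVec]
    have h1 : (G.map ((↑) : ℚ → ℝ))ᵀ * L.map ((↑) : ℚ → ℝ) * G.map ((↑) : ℚ → ℝ) =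
        L.map ((↑) : ℚ → ℝ) := by
      rw [← transpose_map, ← hmapmul, ← hmapmul, hG]
    rw [h1, hLu]
  have hGinv : ∀ {E : Type} [Field E] [CharZero E],
      G.map ((↑) : ℚ → E) * G⁻¹.map ((↑) : ℚ → E) = 1 := by
    intro E _ _
    rw [← hmapmul, mul_nonsing_inv _ hGu]
    simp
  refine ⟨B, G.map ((↑) : ℚ → ℝ) *ᵥ v, w', ?_, ?_, ?_, ?_, ?_, hGv, hGw, ?_⟩
  · have h1 : Gᵀ * (Bᵀ * L * B) * G = Gᵀ * L * G := by
      calc Gᵀ * (Bᵀ * L * B) * G = (B * G)ᵀ * L * (B * G) := by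
            rw [transpose_mul]; simp only [Matrix.mul_assoc]
        _ = Aᵀ * (Gᵀ * L * G) * A := by
            rw [hBG, transpose_mul]; simp only [Matrix.mul_assoc]
        _ = Gᵀ * L * G := by rw [hG, hAL]
    have h2 := hcan _ _ h1
    have hT : (G⁻¹)ᵀ * Gᵀ = 1 := by rw [← transpose_mul, mul_nonsing_inv _ hGu, transpose_one]
    have h3 := congrArg (fun X => (G⁻¹)ᵀ * X) h2
    simpa only [← Matrix.mul_assoc, hT, Matrix.one_mul] using h3
  · apply hcan
    rw [aeval_mul_of_semiconj hBG, hA, Matrix.mul_zero, Matrix.zero_mul]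
  · rw [mulVec_mulVec, ← hmapmul, hBG, hmapmul, ← mulVec_mulVec, hv, mulVec_smul]
  · have h1 : w' ᵥ* B.map ((↑) : ℚ → ℝ) ᵥ* G.map ((↑) : ℚ → ℝ) =
        (lam • w') ᵥ* G.map ((↑) : ℚ → ℝ) := by
      rw [vecMul_vecMul, ← hmapmul, hBG, hmapmul, ← vecMul_vecMul, hwG, hw, smul_vecMul, hwG]
    have h2 := congrArg (fun x => x ᵥ* G⁻¹.map ((↑) : ℚ → ℝ)) h1
    simpa only [vecMul_vecMul, Matrix.mul_assoc, hGinv, Matrix.mul_one, vecMul_one] using h2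
  · rw [dotProduct_mulVec, hwG, dotProduct_comm, hvw]
  · intro x hx
    obtain ⟨c, hc⟩ := huniq (x ᵥ* G.map ((↑) : ℚ → ℂ)) (by
      rw [vecMul_vecMul, ← hmapmul, ← hBG, hmapmul, ← vecMul_vecMul, hx, smul_vecMul])
    refine ⟨c, ?_⟩
    have hwGC : (fun i => (w i : ℂ)) = (fun i => (w' i : ℂ)) ᵥ* G.map ((↑) : ℚ → ℂ) := by
      rw [← hwG]
      ext i
      have := Complex.ofRealHom.map_vecMul (G.map ((↑) : ℚ → ℝ)) w' i
      refine Eq.trans this ?_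
      congr 1
    rw [hwGC, ← smul_vecMul] at hc
    have h2 := congrArg (fun x => x ᵥ* G⁻¹.map ((↑) : ℚ → ℂ)) hc
    simpa only [vecMul_vecMul, hGinv, vecMul_one] using h2

/-- Spectral mapping gives `|lam| ^ n`; evenness of `n` removes the absolute value, as `lam` may be
negative. -/
theorem spectralRadius_pow_eq_of_dominant [Nonempty ι] (B : Matrix ι ι ℂ) (lam : ℝ)
    (hmem : (lam : ℂ) ∈ spectrum ℂ B) (hle : ∀ μ ∈ spectrum ℂ B, ‖μ‖ ≤ |lam|)
    {n : ℕ} (hn : 0 < n) (hev : Even n) : (spectralRadius ℂ (B ^ n)).toReal = lam ^ n := by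
  have h : spectralRadius ℂ (B ^ n) = ENNReal.ofReal (lam ^ n) := by
    have hpos : 0 ≤ lam ^ n := hev.pow_nonneg lam
    apply le_antisymm
    · refine iSup₂_le fun μ hμ => ?_
      rw [spectrum.map_pow_of_pos B hn] at hμ
      obtain ⟨ν, hν, rfl⟩ := hμ
      rw [← enorm_eq_nnnorm, ← ofReal_norm]
      refine ENNReal.ofReal_le_ofReal ?_
      rw [norm_pow, ← hev.pow_abs lam]
      exact pow_le_pow_left₀ (norm_nonneg _) (hle ν hν) n
    · refine le_trans (le_of_eq ?_) (le_iSup₂ (f := fun (k : ℂ) (_ : k ∈ spectrum ℂ (B ^ n)) =>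
        (‖k‖₊ : ENNReal)) _ (spectrum.pow_mem_pow B n hmem))
      rw [← enorm_eq_nnnorm, ← ofReal_norm, norm_pow, Complex.norm_real,
        Real.norm_eq_abs, hev.pow_abs]
  rw [h, ENNReal.toReal_ofReal (hev.pow_nonneg lam)]

end

/-! ### From rational isometries to primitive integral matrices -/

/-- A rational symplectic matrix annihilated by an integer polynomial whose dominant root `lam` is
simple yields a primitive integral symplectic matrix with spectral radius a power of `lam`. -/
theorem exists_primitive_of_rational_matrix {d : ℕ} {L : Matrix (Fin d) (Fin d) ℤ}
    (hL : IsIntegralSymplecticForm L) {A : Matrix (Fin d) (Fin d) ℚ}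
    (hAL : Aᵀ * L.map ((↑) : ℤ → ℚ) * A = L.map ((↑) : ℤ → ℚ)) {m : ℤ[X]} (hmm : m.Monic)
    (hm0 : IsUnit (m.coeff 0)) (hA : aeval A m = 0) {lam : ℝ} (hlam : lam ≠ 0)
    (hm : aeval lam m = 0) (hm' : aeval lam (derivative m) ≠ 0)
    (hroots : ∀ z : ℂ, aeval z m = 0 → z ≠ lam → ‖z‖ < |lam|)
    {w : Fin d → ℝ} (hw0 : w ≠ 0) (hw : w ᵥ* A.map ((↑) : ℚ → ℝ) = lam • w)
    (huniq : ∀ x : Fin d → ℂ, x ᵥ* A.map ((↑) : ℚ → ℂ) = (lam : ℂ) • x →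
      ∃ c : ℂ, x = c • fun i => (w i : ℂ)) :
    ∃ n : ℕ, 0 < n ∧ ∃ M : Matrix (Fin d) (Fin d) ℤ,
      M.IsPrimitive ∧ PreservesForm M L ∧ intSpectralRadius M = lam ^ n := by
  have hLQ : (L.map ((↑) : ℤ → ℚ))ᵀ = -L.map ((↑) : ℤ → ℚ) := by
    rw [← transpose_map, hL.skew]
    ext i j
    simp
  have hdet : IsUnit (L.map ((↑) : ℤ → ℚ)).det := by
    rw [isUnit_iff_ne_zero]
    have h := RingHom.map_det (Int.castRingHom ℚ) L
    have h' : ((L.det : ℤ) : ℚ) ≠ 0 := by exact_mod_cast hL.nondegenerate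
    exact fun h0 => h' (h.trans h0)
  obtain ⟨B, v', w', hBL, hB, hBv, hwB, hwv, hv'pos, hw'pos, huniq'⟩ :=
    exists_symplectic_conj_pos_eigenvectors hLQ hdet hAL hA hm hm' hw0 hw huniq
  have hne : Nonempty (Fin d) := by
    by_contra h
    rw [not_nonempty_iff] at h
    exact hw0 (Subsingleton.elim _ _)
  have hBC : (B.map ((↑) : ℚ → ℝ)).map ((↑) : ℝ → ℂ) = B.map ((↑) : ℚ → ℂ) := by
    ext i j
    simp
  have hBm : aeval (B.map ((↑) : ℚ → ℂ)) m = 0 := by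
    have := aeval_map_ringHom (Rat.castHom ℂ) B m
    rw [hB] at this
    simpa using! this
  have hdom : ∀ (μ : ℂ) (x : Fin d → ℂ), x ≠ 0 → x ᵥ* B.map ((↑) : ℚ → ℂ) = μ • x →
      (μ = lam ∧ ∃ c : ℂ, x = c • fun i => (w' i : ℂ)) ∨ ‖μ‖ < |lam| := by
    intro μ x hx0 hx
    by_cases hμ : μ = lam
    · subst hμ
      exact Or.inl ⟨rfl, huniq' x hx⟩
    · refine Or.inr (hroots μ ?_ hμ)
      have h := vecMul_aeval hx m
      rw [hBm, vecMul_zero] at h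
      exact (smul_eq_zero.1 h.symm).resolve_right hx0
  have hlim := tendsto_pow_dominant (B.map ((↑) : ℚ → ℝ)) lam hlam v' w' hBv hwB hwv
    (fun μ x hx0 hx => (hdom μ x hx0 (by rwa [← hBC])).imp And.right id)
  obtain ⟨k, hk, M₀, hM₀⟩ := exists_pow_eq_map_intCast B m hmm hm0 hB
  have hev : ∀ᶠ n : ℕ in Filter.atTop, ∀ i j,
      0 < (lam ^ n)⁻¹ * ((B.map ((↑) : ℚ → ℝ)) ^ n) i j := by
    rw [Filter.eventually_all]
    intro i
    rw [Filter.eventually_all]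
    exact fun j => (hlim i j).eventually (lt_mem_nhds (mul_pos (hv'pos i) (hw'pos j)))
  obtain ⟨N, hN⟩ := Filter.eventually_atTop.1 hev
  -- A multiple of `k` for integrality, even so that `lam ^ n > 0`, and at least `N` for positivity.
  set n := k * (2 * (N + 1)) with hn
  have hn0 : 0 < n := by positivity
  have hNn : N ≤ n := by nlinarith
  have hnev : Even n := ⟨k * (N + 1), by rw [hn]; ring⟩
  have hM : (M₀ ^ (2 * (N + 1))).map ((↑) : ℤ → ℚ) = B ^ n := by
    rw [hn, pow_mul B, hM₀]
    exact Matrix.map_pow M₀ (Int.castRingHom ℚ) _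
  set M := M₀ ^ (2 * (N + 1)) with hMdef
  have hMpos : ∀ i j, 0 < M i j := by
    intro i j
    have h1 := hN n hNn i j
    have h2 : (0 : ℝ) < lam ^ n := hnev.pow_pos hlam
    have h3 : 0 < ((B.map ((↑) : ℚ → ℝ)) ^ n) i j := (pos_iff_pos_of_mul_pos h1).1 (inv_pos.2 h2)
    have h4 : ((B.map ((↑) : ℚ → ℝ)) ^ n) i j = (M i j : ℝ) := by
      have h5 := congrFun (congrFun (Matrix.map_pow B (Rat.castHom ℝ) n) i) j
      refine h5.symm.trans ?_
      rw [← hM]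
      simp
    rw [h4] at h3
    exact_mod_cast h3
  refine ⟨n, hn0, M, ⟨fun i j => (hMpos i j).le, 1, one_pos, by simpa using hMpos⟩, ?_, ?_⟩
  · have hpres : ∀ l : ℕ, (B ^ l)ᵀ * L.map ((↑) : ℤ → ℚ) * B ^ l = L.map ((↑) : ℤ → ℚ) := by
      intro l
      induction l with
      | zero => simp
      | succ l ih =>
        calc _ = Bᵀ * ((B ^ l)ᵀ * L.map ((↑) : ℤ → ℚ) * B ^ l) * B := by
              rw [pow_succ, transpose_mul]; simp only [Matrix.mul_assoc]
          _ = _ := by rw [ih, hBL]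
    have h := hpres n
    rw [← hM] at h
    have hinj : Function.Injective fun X : Matrix (Fin d) (Fin d) ℤ => X.map ((↑) : ℤ → ℚ) :=
      Matrix.map_injective Int.cast_injective
    apply hinj
    refine Eq.trans ?_ h
    have h1 := Matrix.map_mul (f := Int.castRingHom ℚ) (L := Mᵀ * L) (M := M)
    have h2 := Matrix.map_mul (f := Int.castRingHom ℚ) (L := Mᵀ) (M := L)
    rw [h2] at h1
    exact h1
  · have hMC : M.map ((↑) : ℤ → ℂ) = (B.map ((↑) : ℚ → ℂ)) ^ n := by
      have h1 := Matrix.map_pow B (Rat.castHom ℂ) n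
      refine Eq.trans ?_ h1
      rw [← hM]
      ext i j
      simp
    rw [intSpectralRadius, hMC]
    refine spectralRadius_pow_eq_of_dominant _ lam ?_ (fun μ hμ => ?_) hn0 hnev
    · refine mem_spectrum_iff_exists_vecMul.2 ⟨fun i => (w' i : ℂ), ?_, ?_⟩
      · obtain ⟨i⟩ := hne
        exact fun h => (hw'pos i).ne' (by simpa using congrFun h i)
      · ext i
        have h1 := Complex.ofRealHom.map_vecMul (B.map ((↑) : ℚ → ℝ)) w' i
        rw [hwB] at h1
        rw [← hBC]
        simpa using! h1.symm
    · obtain ⟨x, hx0, hx⟩ := mem_spectrum_iff_exists_vecMul.1 hμ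
      rcases hdom μ x hx0 hx with ⟨rfl, -⟩ | h
      · simp
      · exact h.le

/-- The coordinate-free version: the matrix comes from an isometry `T` of a rational symplectic
space of the right dimension, whose functionals satisfying `ψ ∘ T = lam ψ` are the multiples of
`φ`. -/
theorem exists_primitive_of_isometry {d : ℕ} {L : Matrix (Fin d) (Fin d) ℤ}
    (hL : IsIntegralSymplecticForm L) {V : Type} [AddCommGroup V] [Module ℚ V]
    [FiniteDimensional ℚ V] (hd : Module.finrank ℚ V = d) (B : V →ₗ[ℚ] V →ₗ[ℚ] ℚ)
    (hB : ∀ x, B x x = 0) (hnd : ∀ x, (∀ y, B x y = 0) → x = 0) (T : Module.End ℚ V)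
    (hT : ∀ x y, B (T x) (T y) = B x y) {m : ℤ[X]} (hmm : m.Monic)
    (hm0 : IsUnit (m.coeff 0)) (hTm : aeval T m = 0) {lam : ℝ} (hlam : lam ≠ 0)
    (hm : aeval lam m = 0) (hm' : aeval lam (derivative m) ≠ 0)
    (hroots : ∀ z : ℂ, aeval z m = 0 → z ≠ lam → ‖z‖ < |lam|)
    (φ : V →ₗ[ℚ] ℝ) (hφ0 : φ ≠ 0) (hφ : ∀ x, φ (T x) = lam * φ x)
    (huniq : ∀ ψ : V →ₗ[ℚ] ℂ, (∀ x, ψ (T x) = lam * ψ x) → ∃ c : ℂ, ∀ x, ψ x = c * φ x) :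
    ∃ n : ℕ, 0 < n ∧ ∃ M : Matrix (Fin d) (Fin d) ℤ,
      M.IsPrimitive ∧ PreservesForm M L ∧ intSpectralRadius M = lam ^ n := by
  set Q : (Fin d → ℚ) →ₗ[ℚ] (Fin d → ℚ) →ₗ[ℚ] ℚ :=
    Matrix.toLinearMap₂' ℚ (L.map ((↑) : ℤ → ℚ)) with hQ
  have hQa : ∀ x y, Q x y = x ⬝ᵥ L.map ((↑) : ℤ → ℚ) *ᵥ y :=
    Matrix.toLinearMap₂'_apply' (L.map ((↑) : ℤ → ℚ))
  have hdet : (L.map ((↑) : ℤ → ℚ)).det ≠ 0 := by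
    have h := RingHom.map_det (Int.castRingHom ℚ) L
    have h' : ((L.det : ℤ) : ℚ) ≠ 0 := by exact_mod_cast hL.nondegenerate
    exact fun h0 => h' (h.trans h0)
  have hLQ : (L.map ((↑) : ℤ → ℚ))ᵀ = -L.map ((↑) : ℤ → ℚ) := by
    rw [← transpose_map, hL.skew]
    ext i j
    simp
  have hQnd : ∀ x, (∀ y, Q x y = 0) → x = 0 := fun x hx =>
    Matrix.separatingLeft_def.1 (Matrix.nondegenerate_of_det_ne_zero hdet).1 x
      fun y => (hQa x y).symm.trans (hx y)
  have hQalt : ∀ x, Q x x = 0 := fun x => by rw [hQa, dotProduct_mulVec_self_eq_zero hLQ]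
  obtain ⟨e, he⟩ := exists_linearEquiv_preserving_alternating B Q hB hQalt hnd hQnd (by simp [hd])
  -- In this basis the Gram matrix of `B` is `L`, so the matrix of `T` preserves `L`.
  set b : Module.Basis (Fin d) ℚ V := Module.Basis.ofEquivFun e with hb
  have hgram : ∀ i j, B (b i) (b j) = L.map ((↑) : ℤ → ℚ) i j := by
    intro i j
    rw [← he]
    simp [hb, hQa]
  have hTb : ∀ j, T (b j) = ∑ i, LinearMap.toMatrixAlgEquiv b T i j • b i := by
    intro j
    simp only [LinearMap.toMatrixAlgEquiv_apply]
    exact (b.sum_repr _).symm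
  -- Functionals become row vectors of values on `b`, so eigenfunctionals of `T` are left
  -- eigenvectors of its matrix.
  have hvec : ∀ {F : Type} [Field F] [CharZero F] (ψ : V →ₗ[ℚ] F) (j : Fin d),
      ((fun i => ψ (b i)) ᵥ* (LinearMap.toMatrixAlgEquiv b T).map ((↑) : ℚ → F)) j =
        ψ (T (b j)) := by
    intro F _ _ ψ j
    rw [hTb, map_sum]
    simp only [vecMul, dotProduct, map_apply, map_smul, Rat.smul_def]
    exact Finset.sum_congr rfl fun i _ => mul_comm _ _
  refine exists_primitive_of_rational_matrix hL (A := LinearMap.toMatrixAlgEquiv b T)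
    (w := fun i => φ (b i)) ?_ hmm hm0 ?_ hlam hm hm' hroots ?_ ?_ ?_
  · ext i j
    rw [← hgram, ← hT, hTb, hTb]
    simp only [map_sum, LinearMap.sum_apply, map_smul, LinearMap.smul_apply, hgram, mul_apply,
      transpose_apply, smul_eq_mul, Finset.sum_mul]
    refine Finset.sum_congr rfl fun k _ => ?_
    rw [Finset.mul_sum]
    exact Finset.sum_congr rfl fun l _ => mul_comm _ _
  · have := aeval_int_ringHom_apply
      (LinearMap.toMatrixAlgEquiv b : _ →+* Matrix (Fin d) (Fin d) ℚ) T m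
    rw [hTm, map_zero] at this
    exact this
  · intro h
    exact hφ0 (b.ext fun i => by simpa using congrFun h i)
  · ext j
    rw [hvec, hφ]
    rfl
  · intro x hx
    obtain ⟨c, hc⟩ := huniq (b.constr ℚ x) (by
      intro y
      have : b.constr ℚ x ∘ₗ T = (lam : ℂ) • b.constr ℚ x := by
        refine b.ext fun j => ?_
        have h1 := hvec (b.constr ℚ x) j
        simp only [Module.Basis.constr_basis] at h1
        rw [LinearMap.comp_apply, ← h1, LinearMap.smul_apply, Module.Basis.constr_basis]
        exact congrFun hx j
      exact LinearMap.congr_fun this y)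
    refine ⟨c, funext fun i => ?_⟩
    have := hc (b i)
    rw [Module.Basis.constr_basis] at this
    exact this

/-! ### Filling up the dimension -/

/-- The standard symplectic form on `V × V` with `V = Fin k → ℚ`. -/
def stdForm (k : ℕ) :
    ((Fin k → ℚ) × (Fin k → ℚ)) →ₗ[ℚ] ((Fin k → ℚ) × (Fin k → ℚ)) →ₗ[ℚ] ℚ :=
  LinearMap.mk₂ ℚ (fun x y => x.1 ⬝ᵥ y.2 - x.2 ⬝ᵥ y.1)
    (fun x x' y => by simp [add_dotProduct]; ring) (fun c x y => by simp [smul_dotProduct]; ring)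
    (fun x y y' => by simp [dotProduct_add]; ring) (fun c x y => by simp [dotProduct_smul]; ring)

theorem stdForm_apply {k : ℕ} (x y : (Fin k → ℚ) × (Fin k → ℚ)) :
    stdForm k x y = x.1 ⬝ᵥ y.2 - x.2 ⬝ᵥ y.1 := rfl

theorem stdForm_eq_zero {k : ℕ} (x : (Fin k → ℚ) × (Fin k → ℚ)) (hx : ∀ y, stdForm k x y = 0) :
    x = 0 := by
  ext i
  · simpa [stdForm_apply] using hx (0, Pi.single i 1)
  · simpa [stdForm_apply] using hx (Pi.single i 1, 0)

/-- The dimension of a nondegenerate alternating form over `ℚ` is even. -/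
theorem even_finrank_of_alternating {V : Type} [AddCommGroup V] [Module ℚ V]
    [FiniteDimensional ℚ V] (B : V →ₗ[ℚ] V →ₗ[ℚ] ℚ) (hB : ∀ x, B x x = 0)
    (hnd : ∀ x, (∀ y, B x y = 0) → x = 0) : Even (Module.finrank ℚ V) := by
  by_contra hodd
  rw [Nat.not_even_iff_odd] at hodd
  set b := Module.finBasis ℚ V
  have hswap : ∀ x y, B y x = -B x y := by
    intro x y
    have h := hB (x + y)
    simp only [map_add, LinearMap.add_apply, hB] at h
    linear_combination h
  have hnd' : B.Nondegenerate :=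
    ⟨hnd, fun y hy => hnd y fun x => by rw [hswap, hy, neg_zero]⟩
  have hdet := (LinearMap.BilinForm.nondegenerate_iff_det_ne_zero b).1 hnd'
  apply hdet
  have hskew : (LinearMap.BilinForm.toMatrix b B)ᵀ = -LinearMap.BilinForm.toMatrix b B := by
    ext i j
    simp only [transpose_apply, Matrix.neg_apply, LinearMap.BilinForm.toMatrix_apply]
    exact hswap _ _
  have h := congrArg Matrix.det hskew
  rw [det_transpose, det_neg, Fintype.card_fin, hodd.neg_one_pow] at h
  linarith

theorem map_aeval_apply_of_map_apply {V F : Type} [AddCommGroup V] [Module ℚ V] [Field F]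
    [Algebra ℚ F] {T : Module.End ℚ V} {ψ : V →ₗ[ℚ] F} {μ : F} (h : ∀ x, ψ (T x) = μ * ψ x)
    (p : ℚ[X]) (x : V) : ψ (aeval T p x) = aeval μ p * ψ x := by
  induction p using Polynomial.induction_on' with
  | add p q hp hq => rw [map_add, map_add, LinearMap.add_apply, map_add, hp, hq, add_mul]
  | monomial n a =>
    have hpow : ∀ x, ψ ((T ^ n) x) = μ ^ n * ψ x := by
      induction n with
      | zero => simp
      | succ n ih => intro x; rw [pow_succ, Module.End.mul_apply, ih, h, pow_succ, mul_assoc]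
    rw [aeval_monomial, aeval_monomial, Module.End.mul_apply, Module.algebraMap_end_apply, map_smul,
      hpow, Algebra.smul_def, mul_assoc]

/-- `exists_primitive_of_isometry` for a space `V` of dimension at most `2 * h`: complete `V` by a
symplectic space on which the isometry is the identity. -/
theorem exists_primitive_of_isometry_of_finrank_le {h : ℕ}
    {L : Matrix (Fin (2 * h)) (Fin (2 * h)) ℤ}
    (hL : IsIntegralSymplecticForm L) {V : Type} [AddCommGroup V] [Module ℚ V]
    [FiniteDimensional ℚ V] (hd : Module.finrank ℚ V ≤ 2 * h) (B : V →ₗ[ℚ] V →ₗ[ℚ] ℚ)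
    (hB : ∀ x, B x x = 0) (hnd : ∀ x, (∀ y, B x y = 0) → x = 0) (T : Module.End ℚ V)
    (hT : ∀ x y, B (T x) (T y) = B x y) {m : ℤ[X]} (hmm : m.Monic)
    (hm0 : IsUnit (m.coeff 0)) (hTm : aeval T m = 0) {lam : ℝ} (hlam : 1 < |lam|)
    (hm : aeval lam m = 0) (hm' : aeval lam (derivative m) ≠ 0)
    (hroots : ∀ z : ℂ, aeval z m = 0 → z ≠ lam → ‖z‖ < |lam|)
    (φ : V →ₗ[ℚ] ℝ) (hφ0 : φ ≠ 0) (hφ : ∀ x, φ (T x) = lam * φ x)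
    (huniq : ∀ ψ : V →ₗ[ℚ] ℂ, (∀ x, ψ (T x) = lam * ψ x) → ∃ c : ℂ, ∀ x, ψ x = c * φ x) :
    ∃ n : ℕ, 0 < n ∧ ∃ M : Matrix (Fin (2 * h)) (Fin (2 * h)) ℤ,
      M.IsPrimitive ∧ PreservesForm M L ∧ intSpectralRadius M = lam ^ n := by
  have hlam1 : lam ≠ 1 := by
    rintro rfl
    simp at hlam
  obtain ⟨j, hj⟩ := even_finrank_of_alternating B hB hnd
  -- `dim V = 2j`, so a symplectic complement of dimension `2(h - j)` is needed.
  let W := (Fin (h - j) → ℚ) × (Fin (h - j) → ℚ)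
  let B' : (V × W) →ₗ[ℚ] (V × W) →ₗ[ℚ] ℚ :=
    B.compl₁₂ (LinearMap.fst ℚ V W) (LinearMap.fst ℚ V W) +
      (stdForm (h - j)).compl₁₂ (LinearMap.snd ℚ V W) (LinearMap.snd ℚ V W)
  have hB' : ∀ x y, B' x y = B x.1 y.1 + stdForm (h - j) x.2 y.2 := fun x y => rfl
  -- The factor `X - 1` kills the identity part; since `|lam| > 1`, `lam` stays a simple and
  -- dominant root.
  have hend : aeval (LinearMap.prodMapAlgHom ℚ V W (T, 1)) (m * (X - 1)) = 0 := by
    have h1 : aeval (T, (1 : Module.End ℚ W)) (m * (X - 1)) = 0 := by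
      rw [aeval_prod_apply]
      simp [hTm]
    have h2 := aeval_int_ringHom_apply
      (LinearMap.prodMapAlgHom ℚ V W : _ →+* Module.End ℚ (V × W)) (T, (1 : Module.End ℚ W))
      (m * (X - 1))
    rw [h1, map_zero] at h2
    exact h2
  refine exists_primitive_of_isometry hL (V := V × W) ?_ B' ?_ ?_
    (LinearMap.prodMapAlgHom ℚ V W (T, 1)) ?_ (m := m * (X - 1)) ?_ ?_ hend
    (lam := lam) ?_ ?_ ?_ ?_ (φ ∘ₗ LinearMap.fst ℚ V W) ?_ ?_ ?_
  · simp only [W, Module.finrank_prod, Module.finrank_fin_fun]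
    omega
  · intro x
    rw [hB', hB, stdForm_apply, dotProduct_comm]
    simp
  · intro x hx
    have h1 : x.1 = 0 := hnd _ fun y => by simpa [hB'] using hx (y, 0)
    have h2 : x.2 = 0 := stdForm_eq_zero _ fun y => by simpa [hB'] using hx (0, y)
    exact Prod.ext h1 h2
  · intro x y
    rw [hB', hB']
    exact congrArg (· + _) (hT x.1 y.1)
  · exact hmm.mul (monic_X_sub_C 1)
  · rw [mul_coeff_zero]
    simpa using hm0
  · rintro rfl
    norm_num at hlam
  · rw [map_mul, hm, zero_mul]
  · rw [derivative_mul, map_add, map_mul, map_mul, hm, zero_mul, add_zero]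
    refine mul_ne_zero hm' ?_
    simpa [sub_eq_zero] using hlam1
  · intro z hz hne
    rw [map_mul, mul_eq_zero] at hz
    rcases hz with hz | hz
    · exact hroots z hz hne
    · have : z = 1 := by simpa [sub_eq_zero] using hz
      rw [this, norm_one]
      exact hlam
  · intro h0
    refine hφ0 (LinearMap.ext fun x => ?_)
    exact LinearMap.congr_fun h0 (x, 0)
  · intro x
    exact hφ x.1
  · intro ψ hψ
    obtain ⟨c, hc⟩ := huniq (ψ ∘ₗ LinearMap.inl ℚ V W) fun x => by
      simpa using hψ (x, 0)
    refine ⟨c, fun x => ?_⟩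
    have h1 : ψ (0, x.2) = lam * ψ (0, x.2) := by simpa using hψ (0, x.2)
    have h2 : ψ (0, x.2) = 0 := by
      have h3 : ((lam : ℂ) - 1) * ψ (0, x.2) = 0 := by linear_combination -h1
      refine (mul_eq_zero.1 h3).resolve_left (sub_ne_zero.2 ?_)
      exact_mod_cast hlam1
    have h3 : x = (x.1, 0) + (0, x.2) := by simp
    rw [h3, map_add, h2, add_zero]
    exact (hc x.1).trans (by simp)

/-! ### The isometries built from `ℚ(lam)` -/

section

open IntermediateField

theorem lmul_apply_apply {R A : Type*} [CommSemiring R] [Semiring A] [Algebra R A] (a b : A) :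
    Algebra.lmul R A a b = a * b := rfl

variable (lam : ℝ)

/-- The generator of `ℚ(lam)`. -/
noncomputable abbrev gen : ℚ⟮lam⟯ := AdjoinSimple.gen ℚ lam

variable {lam}

theorem aeval_gen_eq_zero_iff (p : ℤ[X]) : aeval (gen lam) p = 0 ↔ aeval lam p = 0 := by
  have h : aeval lam p = algebraMap ℚ⟮lam⟯ ℝ (aeval (gen lam) p) := by
    rw [← aeval_algebraMap_apply]
    rfl
  rw [h, FaithfulSMul.algebraMap_eq_zero_iff]

theorem minpoly_rat_eq (hlam : IsIntegral ℤ lam) :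
    minpoly ℚ lam = (minpoly ℤ lam).map (algebraMap ℤ ℚ) :=
  minpoly.isIntegrallyClosed_eq_field_fractions' ℚ hlam

theorem exists_aeval_gen (hlam : IsIntegral ℤ lam) (x : ℚ⟮lam⟯) :
    ∃ q : ℚ[X], x = aeval (gen lam) q := by
  have hint : IsIntegral ℚ lam := hlam.tower_top
  obtain ⟨q, hq⟩ := (adjoin.powerBasis hint).exists_eq_aeval' x
  refine ⟨q, hq.trans ?_⟩
  rw [adjoin.powerBasis_gen]
  congr!

/-- A functional on `ℚ(lam)` that is an eigenvector of the multiplication by `lam`. -/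
theorem functional_eq_smul (hlam : IsIntegral ℤ lam) (ψ : ℚ⟮lam⟯ →ₗ[ℚ] ℂ)
    (h : ∀ x, ψ (gen lam * x) = lam * ψ x) (x : ℚ⟮lam⟯) :
    ψ x = ψ 1 * ((x : ℝ) : ℂ) := by
  -- An eigenfunctional is determined by its value at 1, because `1` generates `ℚ(lam)` over
  -- `ℚ[lam]`.
  obtain ⟨q, rfl⟩ := exists_aeval_gen hlam x
  have h1 := map_aeval_apply_of_map_apply (T := Algebra.lmul ℚ ℚ⟮lam⟯ (gen lam)) (ψ := ψ) h q 1
  rw [aeval_algHom_apply] at h1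
  rw [lmul_apply_apply, mul_one] at h1
  rw [h1, mul_comm]
  congr 1
  have h2 : ((aeval (gen lam) q : ℚ⟮lam⟯) : ℝ) = aeval lam q := by
    have := aeval_algebraMap_apply ℝ (gen lam) q
    exact this.symm
  rw [h2]
  exact (aeval_algebraMap_apply ℂ lam q)

theorem aeval_inv_reverse_eq_zero_iff {F : Type*} [Field F] {x : F} (hx : x ≠ 0) (p : ℤ[X]) :
    aeval x⁻¹ p.reverse = 0 ↔ aeval x p = 0 := by
  have := invertibleOfNonzero hx
  rw [← invOf_eq_inv]
  exact eval₂_reverse_eq_zero_iff _ x p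

theorem aeval_inv_eq_zero_iff {F : Type*} [Field F] {x : F} (hx : x ≠ 0) (p : ℤ[X]) :
    aeval x⁻¹ p = 0 ↔ aeval x p.reverse = 0 := by
  have := invertibleOfNonzero (inv_ne_zero hx)
  have h := eval₂_reverse_eq_zero_iff (algebraMap ℤ F) x⁻¹ p
  rw [invOf_eq_inv, inv_inv] at h
  exact h.symm

theorem aeval_derivative_minpoly_ne_zero (hlam : IsIntegral ℤ lam) :
    aeval lam (derivative (minpoly ℤ lam)) ≠ 0 := by
  have hint : IsIntegral ℚ lam := hlam.tower_top
  have h := (minpoly.irreducible hint).separable.aeval_derivative_ne_zero (minpoly.aeval ℚ lam)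
  rwa [minpoly_rat_eq hlam, derivative_map, aeval_map_algebraMap] at h

theorem finrank_adjoin_eq (hlam : IsIntegral ℤ lam) :
    Module.finrank ℚ ℚ⟮lam⟯ = (minpoly ℤ lam).natDegree := by
  have hint : IsIntegral ℚ lam := hlam.tower_top
  rw [adjoin.finrank hint, minpoly_rat_eq hlam, (minpoly.monic hlam).natDegree_map]

theorem traceForm_eq_zero [FiniteDimensional ℚ ℚ⟮lam⟯] (x : ℚ⟮lam⟯)
    (h : ∀ y, Algebra.trace ℚ ℚ⟮lam⟯ (x * y) = 0) : x = 0 :=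
  (traceForm_nondegenerate ℚ ℚ⟮lam⟯).1 x h

/-- The involution `σ : lam ↦ lam⁻¹` of `ℚ(lam)` gives the form `tr(c x σ(y))`, which is alternating
because `σ(c) = -c` and invariant under multiplication by `lam` because `lam σ(lam) = 1`. -/
theorem primitive_of_reciprocal (hlam : IsPerronUnit lam) {h : ℕ}
    (hh : (minpoly ℤ lam).natDegree ≤ h) {L : Matrix (Fin (2 * h)) (Fin (2 * h)) ℤ}
    (hL : IsIntegralSymplecticForm L) (hrec : aeval lam⁻¹ (minpoly ℤ lam) = 0) :
    ∃ n : ℕ, 0 < n ∧ ∃ M : Matrix (Fin (2 * h)) (Fin (2 * h)) ℤ,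
      M.IsPrimitive ∧ PreservesForm M L ∧ intSpectralRadius M = lam ^ n := by
  have hI := hlam.isAlgebraicUnit.1
  have hint : IsIntegral ℚ lam := hI.tower_top
  have : FiniteDimensional ℚ ℚ⟮lam⟯ := adjoin.finiteDimensional hint
  have hlam0 : lam ≠ 0 := by
    rintro rfl
    have := hlam.one_lt_abs
    norm_num at this
  have hg0 : gen lam ≠ 0 := fun h0 => hlam0 (congrArg Subtype.val h0)
  obtain ⟨σ, hσ⟩ : ∃ σ : ℚ⟮lam⟯ →ₐ[ℚ] ℚ⟮lam⟯, σ (gen lam) = (gen lam)⁻¹ := by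
    have hmin : minpoly ℚ (adjoin.powerBasis hint).gen = minpoly ℚ lam := by
      rw [adjoin.powerBasis_gen]
      exact IntermediateField.minpoly_gen ℚ lam
    have hroot : aeval (gen lam)⁻¹ (minpoly ℚ (adjoin.powerBasis hint).gen) = 0 := by
      rw [hmin, minpoly_rat_eq hI, aeval_map_algebraMap,
        aeval_inv_eq_zero_iff hg0, aeval_gen_eq_zero_iff, ← aeval_inv_eq_zero_iff hlam0, hrec]
    refine ⟨(adjoin.powerBasis hint).lift _ hroot, ?_⟩
    have := (adjoin.powerBasis hint).lift_gen _ hroot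
    rwa [adjoin.powerBasis_gen] at this
  have hσσ : ∀ x, σ (σ x) = x := by
    intro x
    obtain ⟨q, rfl⟩ := exists_aeval_gen hI x
    rw [← aeval_algHom_apply, ← aeval_algHom_apply, hσ, map_inv₀, hσ, inv_inv]
  let σe : ℚ⟮lam⟯ ≃ₐ[ℚ] ℚ⟮lam⟯ := AlgEquiv.ofAlgHom σ σ (AlgHom.ext hσσ) (AlgHom.ext hσσ)
  have htr : ∀ x, Algebra.trace ℚ ℚ⟮lam⟯ (σ x) = Algebra.trace ℚ ℚ⟮lam⟯ x :=
    fun x => Algebra.trace_eq_of_algEquiv σe x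
  set c : ℚ⟮lam⟯ := gen lam - (gen lam)⁻¹ with hc
  have hσc : σ c = -c := by
    rw [hc, map_sub, map_inv₀, hσ, inv_inv, neg_sub]
  have hc0 : c ≠ 0 := by
    intro h0
    have h1 : gen lam * gen lam = 1 := by
      rw [hc, sub_eq_zero] at h0
      nth_rw 2 [h0]
      exact mul_inv_cancel₀ hg0
    have h2 : lam * lam = 1 := congrArg Subtype.val h1
    have := hlam.one_lt_abs
    have h3 : |lam| * |lam| = 1 := by rw [← abs_mul, h2, abs_one]
    nlinarith
  let B : ℚ⟮lam⟯ →ₗ[ℚ] ℚ⟮lam⟯ →ₗ[ℚ] ℚ :=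
    (LinearMap.mul ℚ ℚ⟮lam⟯).compl₁₂ (LinearMap.mulLeft ℚ c) σ.toLinearMap |>.compr₂
      (Algebra.trace ℚ ℚ⟮lam⟯)
  have hB : ∀ x y, B x y = Algebra.trace ℚ ℚ⟮lam⟯ (c * x * σ y) := fun x y => rfl
  refine exists_primitive_of_isometry_of_finrank_le hL (V := ℚ⟮lam⟯) ?_ B ?_ ?_
    (Algebra.lmul ℚ ℚ⟮lam⟯ (gen lam)) ?_ (m := minpoly ℤ lam) (minpoly.monic hI) ?_ ?_
    hlam.one_lt_abs (minpoly.aeval ℤ lam) (aeval_derivative_minpoly_ne_zero hI) ?_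
    (ℚ⟮lam⟯.val.toLinearMap) ?_ ?_ ?_
  · rw [finrank_adjoin_eq hI]
    omega
  · intro x
    -- `σ` negates `c x σ(x)` and preserves the trace, so this trace is its own negative.
    have h1 := htr (c * x * σ x)
    rw [map_mul σ, map_mul σ, hσc, hσσ, show -c * σ x * x = -(c * x * σ x) by ring, map_neg] at h1
    rw [hB]
    linarith
  · intro x hx
    have h1 := traceForm_eq_zero (c * x) fun y => by
      have := hx (σ y)
      rwa [hB, hσσ] at this
    exact (mul_eq_zero.1 h1).resolve_left hc0
  · intro x y
    rw [hB, hB, lmul_apply_apply, lmul_apply_apply, map_mul σ, hσ]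
    congr 1
    field_simp
  · exact Int.isUnit_iff.2 hlam.isAlgebraicUnit.2
  · have := aeval_int_ringHom_apply
      (Algebra.lmul ℚ ℚ⟮lam⟯ : _ →+* Module.End ℚ ℚ⟮lam⟯) (gen lam) (minpoly ℤ lam)
    rw [(aeval_gen_eq_zero_iff _).2 (minpoly.aeval ℤ lam), map_zero] at this
    exact this
  · intro z hz hne
    exact hlam.norm_lt z (by rw [selfReciprocal, map_mul, hz, zero_mul]) hne
  · intro h0
    simpa using LinearMap.congr_fun h0 1
  · intro x
    rfl
  · intro ψ hψ
    exact ⟨ψ 1, functional_eq_smul hI ψ hψ⟩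

/-- The eigenvalue `lam⁻¹` needs its own copy of `K`. The trace form pairs the two copies, where
`lam` and `lam⁻¹` cancel; the dimension `2g` fits because `g ≤ h`. -/
theorem primitive_of_not_reciprocal (hlam : IsPerronUnit lam) {h : ℕ}
    (hh : (minpoly ℤ lam).natDegree ≤ h) {L : Matrix (Fin (2 * h)) (Fin (2 * h)) ℤ}
    (hL : IsIntegralSymplecticForm L) (hrec : aeval lam⁻¹ (minpoly ℤ lam) ≠ 0) :
    ∃ n : ℕ, 0 < n ∧ ∃ M : Matrix (Fin (2 * h)) (Fin (2 * h)) ℤ,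
      M.IsPrimitive ∧ PreservesForm M L ∧ intSpectralRadius M = lam ^ n := by
  have hI := hlam.isAlgebraicUnit.1
  have hint : IsIntegral ℚ lam := hI.tower_top
  have : FiniteDimensional ℚ ℚ⟮lam⟯ := adjoin.finiteDimensional hint
  have hlam0 : lam ≠ 0 := by
    rintro rfl
    have := hlam.one_lt_abs
    norm_num at this
  have hg0 : gen lam ≠ 0 := fun h0 => hlam0 (congrArg Subtype.val h0)
  set p := minpoly ℤ lam with hp
  have hp0 : IsUnit (p.coeff 0) := Int.isUnit_iff.2 hlam.isAlgebraicUnit.2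
  have hpm : p.Monic := minpoly.monic hI
  have hsq : p.coeff 0 * p.coeff 0 = 1 := Int.isUnit_mul_self hp0
  let K := ℚ⟮lam⟯
  let T : K × K := (gen lam, (gen lam)⁻¹)
  -- The leading coefficient of `p.reverse` is `p(0) = ±1`; multiplying by it makes `s` monic.
  let s : ℤ[X] := C (p.coeff 0) * p.reverse
  have hs : s.Monic := by
    have hlead : p.reverse.leadingCoeff = p.coeff 0 := by
      rw [reverse_leadingCoeff, trailingCoeff, natTrailingDegree_eq_zero.2 (Or.inr hp0.ne_zero)]
    rw [Monic, leadingCoeff_mul, leadingCoeff_C, hlead, hsq]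
  have hplam : aeval lam p = 0 := minpoly.aeval ℤ lam
  have hunit : (algebraMap ℤ ℝ (p.coeff 0)) ≠ 0 := (hp0.map (algebraMap ℤ ℝ)).ne_zero
  have hTs : aeval T (p * s) = 0 := by
    rw [aeval_prod_apply]
    refine Prod.ext ?_ ?_
    · simp only [map_mul, T]
      rw [(aeval_gen_eq_zero_iff _).2 hplam, zero_mul]
      rfl
    · simp only [map_mul, T, s]
      rw [(aeval_inv_reverse_eq_zero_iff hg0 p).2 ((aeval_gen_eq_zero_iff _).2 hplam), mul_zero,
        mul_zero]
      rfl
  let B : (K × K) →ₗ[ℚ] (K × K) →ₗ[ℚ] ℚ :=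
    (LinearMap.mul ℚ K).compl₁₂ (LinearMap.fst ℚ K K) (LinearMap.snd ℚ K K) -
      (LinearMap.mul ℚ K).compl₁₂ (LinearMap.snd ℚ K K) (LinearMap.fst ℚ K K) |>.compr₂
      (Algebra.trace ℚ K)
  have hB : ∀ x y, B x y = Algebra.trace ℚ K (x.1 * y.2 - x.2 * y.1) := fun x y => rfl
  refine exists_primitive_of_isometry_of_finrank_le hL (V := K × K) ?_ B ?_ ?_
    (Algebra.lmul ℚ (K × K) T) ?_ (m := p * s) (hpm.mul hs) ?_ ?_
    hlam.one_lt_abs ?_ ?_ ?_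
    (ℚ⟮lam⟯.val.toLinearMap ∘ₗ LinearMap.fst ℚ K K) ?_ ?_ ?_
  · rw [Module.finrank_prod, finrank_adjoin_eq hI, ← hp]
    omega
  · intro x
    rw [hB, mul_comm x.1, sub_self, map_zero]
  · intro x hx
    refine Prod.ext ?_ ?_
    · refine traceForm_eq_zero x.1 fun y => ?_
      simpa [hB] using hx (0, y)
    · refine traceForm_eq_zero x.2 fun y => ?_
      simpa [hB] using hx (y, 0)
  · intro x y
    rw [hB, hB, lmul_apply_apply, lmul_apply_apply]
    congr 1
    simp only [Prod.fst_mul, Prod.snd_mul, T]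
    field_simp
  · rw [mul_coeff_zero, coeff_C_mul, coeff_zero_reverse, hpm.leadingCoeff, mul_one, hsq]
    exact isUnit_one
  · have := aeval_int_ringHom_apply
      (Algebra.lmul ℚ (K × K) : _ →+* Module.End ℚ (K × K)) T (p * s)
    have h1 := hTs
    rw [h1, map_zero] at this
    exact this
  · rw [map_mul, hplam, zero_mul]
  · rw [derivative_mul, map_add, map_mul, map_mul _ p, hplam, zero_mul, add_zero]
    refine mul_ne_zero (aeval_derivative_minpoly_ne_zero hI) ?_
    rw [map_mul, aeval_C]
    -- `lam` is not a root of `s`, hence a simple root of `p * s`, exactly because `lam⁻¹` is not a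
    -- conjugate.
    exact mul_ne_zero hunit fun h0 => hrec ((aeval_inv_eq_zero_iff hlam0 p).2 h0)
  · intro z hz hne
    refine hlam.norm_lt z ?_ hne
    rw [selfReciprocal, map_mul]
    simp only [s, map_mul, aeval_C] at hz
    have hunit' : (algebraMap ℤ ℂ (p.coeff 0)) ≠ 0 := (hp0.map (algebraMap ℤ ℂ)).ne_zero
    rcases mul_eq_zero.1 hz with hz | hz
    · rw [hz, zero_mul]
    · rw [(mul_eq_zero.1 hz).resolve_left hunit', mul_zero]
  · intro h0
    simpa using LinearMap.congr_fun h0 (1, 0)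
  · intro x
    rfl
  · intro ψ hψ
    have h1 := functional_eq_smul hI (ψ ∘ₗ LinearMap.inl ℚ K K) fun x => by
      have := hψ (x, 0)
      simp only [T, lmul_apply_apply, Prod.mk_mul_mk, mul_zero] at this
      exact this
    -- On the second copy multiplication by `lam` acts on `ψ` as `lam⁻¹`, so `p(lam⁻¹) ψ = 0` there
    -- and `ψ` vanishes.
    have h2 : ∀ y, ψ (0, y) = 0 := by
      have h3 : ∀ y, (ψ ∘ₗ LinearMap.inr ℚ K K) (Algebra.lmul ℚ K (gen lam) y) =
          (lam : ℂ)⁻¹ * (ψ ∘ₗ LinearMap.inr ℚ K K) y := by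
        intro y
        have := hψ (0, gen lam * y)
        have hlamC : (lam : ℂ) ≠ 0 := by exact_mod_cast hlam0
        simp only [T, lmul_apply_apply, Prod.mk_mul_mk, mul_zero,
          inv_mul_cancel_left₀ hg0] at this
        simp only [LinearMap.comp_apply, LinearMap.inr_apply, lmul_apply_apply]
        rw [this, inv_mul_cancel_left₀ hlamC]
      intro y
      have h4 := map_aeval_apply_of_map_apply h3 (p.map (algebraMap ℤ ℚ)) y
      rw [aeval_algHom_apply, aeval_map_algebraMap, aeval_map_algebraMap,
        (aeval_gen_eq_zero_iff _).2 hplam, map_zero, LinearMap.zero_apply, map_zero] at h4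
      refine (mul_eq_zero.1 h4.symm).resolve_left fun h5 => hrec ?_
      have h6 : aeval (algebraMap ℝ ℂ lam⁻¹) p = 0 := by
        rw [← h5]
        simp
      rwa [aeval_algebraMap_apply, map_eq_zero] at h6
    refine ⟨ψ (1, 0), fun x => ?_⟩
    have h3 : x = (x.1, 0) + (0, x.2) := by simp
    conv_lhs => rw [h3, map_add, h2, add_zero]
    exact h1 x.1

end

end PerronUnit

theorem mainTheorem1 (lam : ℝ) (hlam : PerronUnit.IsPerronUnit lam)
    (h : ℕ) (hh : (minpoly ℤ lam).natDegree ≤ h)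
    (L : Matrix (Fin (2 * h)) (Fin (2 * h)) ℤ) (hL : PerronUnit.IsIntegralSymplecticForm L) :
    ∃ n : ℕ, 0 < n ∧ ∃ M : Matrix (Fin (2 * h)) (Fin (2 * h)) ℤ,
      M.IsPrimitive ∧ PerronUnit.PreservesForm M L ∧
        PerronUnit.intSpectralRadius M = lam ^ n := by
  by_cases hrec : aeval lam⁻¹ (minpoly ℤ lam) = 0
  · exact PerronUnit.primitive_of_reciprocal hlam hh hL hrec
  · exact PerronUnit.primitive_of_not_reciprocal hlam hh hL hrec
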